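/- Let $\mathbb K\in\{\mathbb R,\mathbb C\}$, let $X,U$ be Banach spaces over $\mathbb K$, let $A$ generate a $C_0$-semigroup $(T(t))_{t\ge0}$ on $X$, and let $X_{-1}$ be the completion of $X$ for the norm $\|x\|_{-1}=\|(\lambda I-A)^{-1}x\|$ with some $\lambda\in\rho(A)$. Let $T_{-1}(t)$ be the continuous extension of $T(t)$ to $X_{-1}$, and let $B\in\mathcal L(U,X_{-1})$. The mild solution of the system $\Sigma(A,B)$ with initial value $x_0\in X$ and input $u$ is $$x(t)=T(t)x_0+\int_0^tT_{-1}(t-s)Bu(s)\,ds\in X_{-1},\qquad t\ge 0.$$ A Young function is a function $\Phi(t)=\int_0^t\varphi(s)\,ds$, $t\ge0$, where $\varphi:[0,\infty)\to\mathbb R$ is right-continuous and nondecreasing, $\varphi(0)=0$, $\varphi(s)>0$ for $s>0$ and $\varphi(s)\to\infty$ as $s\to\infty$. $L_\Phi(0,t;U)$ is the space of (classes of) Bochner-measurable $u:(0,t)\to U$ with $\int_0^t\Phi(\|u(s)\|/k)\,ds<\infty$ for some $k>0$, with the Luxemburg norm $\|u\|_\Phi=\inf\{k>0:\int_0^t\Phi(\|u(s)\|/k)\,ds\le1\}$,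 and $E_\Phi(0,t;U)$ is the closure of $L^\infty(0,t;U)$ in it, with the same norm. Let $\mathcal K$ be the set of continuous strictly increasing $\mu:[0,\infty)\to[0,\infty)$ with $\mu(0)=0$, let $\mathcal K_\infty$ be the set of unbounded elements of $\mathcal K$, and let $\mathcal L$ be the set of continuous strictly decreasing $\gamma:[0,\infty)\to[0,\infty)$ with $\gamma(t)\to0$ as $t\to\infty$. For $Z=E_\Phi$ or $Z=L^\infty$: * $\Sigma(A,B)$ is $Z$-sISS if there are $\mu\in\mathcal K$ and $\beta:X\times[0,\infty)\to[0,\infty)$ with $\beta(x,\cdot)\in\mathcal L$ for all $x\ne0$ such that for all $t\ge0$, $x_0\in X$, $u\in Z(0,t;U)$ we have $x(t)\in X$ and $\|x(t)\|\le\beta(x_0,t)+\mu(\|u\|_{Z(0,t;U)})$. * $\Sigma(A,B)$ is $Z$-siISS if there are $\theta\in\mathcal K_\infty$, $\mu\in\mathcal K$ and $\beta$ as above such that for all $t\ge0$, $x_0\in X$, $u\in Z(0,t;U)$ we have $x(t)\in X$ and $\|x(t)\|\le\beta(x_0,t)+\theta\big(\int_0^t\mu(\|u(s)\|_U)\,ds\big)$,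 the integral being finite. * $\Sigma(A,B)$ is infinite-time $Z$-admissible if $\int_0^tT_{-1}(s)Bu(s)\,ds\in X$ for all $t>0$, $u\in Z(0,t;U)$, and there is a constant $c$ with $\big\|\int_0^tT_{-1}(s)Bu(s)\,ds\big\|_X\le c\,\|u\|_{Z(0,t;U)}$ for all such $t$ and $u$. * $(T(t))_{t\ge0}$ is strongly stable if $T(t)x\to0$ as $t\to\infty$ for every $x\in X$. **Theorem.** For every Young function $\Phi$, $\Sigma(A,B)$ is $E_\Phi$-sISS if and only if it is infinite-time $E_\Phi$-admissible and $(T(t))_{t\ge0}$ is strongly stable. If there is a Young function $\Phi$ such that $\Sigma(A,B)$ is $E_\Phi$-sISS, then $\Sigma(A,B)$ is $L^\infty$-siISS. -/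

import Mathlib

open MeasureTheory Filter Topology Set
open scoped NNReal ENNReal

noncomputable section

namespace StrongISS

/-! ### `C₀`-semigroups, generators and resolvents -/

/-- A strongly continuous semigroup `(T(t))_{t ≥ 0}` of bounded operators on `X`. -/
structure C0Semigroup (𝕜 X : Type*) [RCLike 𝕜] [NormedAddCommGroup X] [NormedSpace 𝕜 X] where
  /-- the operator `T(t)` -/
  op : ℝ≥0 → X →L[𝕜] X
  op_zero : op 0 = ContinuousLinearMap.id 𝕜 X
  op_add : ∀ s t : ℝ≥0, op (s + t) = (op s).comp (op t)
  continuous_orbit : ∀ x : X, Continuous fun t : ℝ≥0 => op t x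

section Space

variable {𝕜 X : Type*} [RCLike 𝕜] [NormedAddCommGroup X] [NormedSpace 𝕜 X]

/-- The (unbounded) operator `A` generates `T`: `x ∈ D(A)` and `A x = y` if and only if
`(T(h) x - x) / h → y` as `h ↓ 0`. -/
def IsGenerator (A : X →ₗ.[𝕜] X) (T : C0Semigroup 𝕜 X) : Prop :=
  ∀ x y : X, (x, y) ∈ A.graph ↔
    Tendsto (fun h : ℝ≥0 => (((h : ℝ)⁻¹ : ℝ) : 𝕜) • (T.op h x - x)) (𝓝[>] 0) (𝓝 y)

/-- `(T(t))_{t ≥ 0}` is strongly stable: `T(t) x → 0` as `t → ∞` for all `x`. -/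
def C0Semigroup.StronglyStable (T : C0Semigroup 𝕜 X) : Prop :=
  ∀ x : X, Tendsto (fun t : ℝ≥0 => T.op t x) atTop (𝓝 0)

/-- The bounded operator `R` is the inverse of `lam I - A : D(A) → X`. -/
def IsResolventAt (A : X →ₗ.[𝕜] X) (lam : 𝕜) (R : X →L[𝕜] X) : Prop :=
  (∀ x : A.domain, R (lam • (x : X) - A x) = x) ∧
    ∀ y : X, ∃ x : A.domain, (x : X) = R y ∧ lam • (x : X) - A x = y

/-- The resolvent set `ρ(A)` of an unbounded operator. -/
def resolventSet (A : X →ₗ.[𝕜] X) : Set 𝕜 :=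
  {lam | ∃ R : X →L[𝕜] X, IsResolventAt A lam R}

variable {A : X →ₗ.[𝕜] X} {lam : 𝕜}

/-- The resolvent `(lam I - A)⁻¹` for `lam ∈ ρ(A)`. -/
def resolvent (hlam : lam ∈ resolventSet A) : X →L[𝕜] X := hlam.choose

theorem resolvent_spec (hlam : lam ∈ resolventSet A) :
    IsResolventAt A lam (resolvent hlam) := hlam.choose_spec

theorem resolvent_injective (hlam : lam ∈ resolventSet A) :
    Function.Injective (resolvent hlam) := by
  intro y z hyz
  obtain ⟨a, ha, ha'⟩ := (resolvent_spec hlam).2 y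
  obtain ⟨b, hb, hb'⟩ := (resolvent_spec hlam).2 z
  have hab : a = b := Subtype.ext (by rw [ha, hb, hyz])
  rw [← ha', ← hb', hab]

/-- The resolvent commutes with the semigroup. -/
theorem resolvent_comm {T : C0Semigroup 𝕜 X} (hA : IsGenerator A T)
    (hlam : lam ∈ resolventSet A) (t : ℝ≥0) (x : X) :
    resolvent hlam (T.op t x) = T.op t (resolvent hlam x) := by
  obtain ⟨a, ha, ha'⟩ := (resolvent_spec hlam).2 x
  have h1 : ((a : X), A a) ∈ A.graph := A.mem_graph a
  have h2 : (T.op t a, T.op t (A a)) ∈ A.graph := by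
    rw [hA] at h1 ⊢
    have h3 := ((T.op t).continuous.tendsto (A a)).comp h1
    refine h3.congr fun h => ?_
    have h4 : T.op t (T.op h a) = T.op h (T.op t a) := by
      rw [← ContinuousLinearMap.comp_apply, ← ContinuousLinearMap.comp_apply,
        ← T.op_add, ← T.op_add, add_comm]
    simp only [Function.comp_apply, map_smul, map_sub, h4]
  obtain ⟨b, hb, hb'⟩ := (LinearPMap.mem_graph_iff A).1 h2
  have h5 := (resolvent_spec hlam).1 b
  simp only at hb hb'
  rw [hb', hb, ← map_smul, ← map_sub, ha', ha] at h5
  exact h5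

/-! ### The extrapolation space `X₋₁` -/

/-- The space `X`, to be equipped with the norm `‖x‖₋₁ = ‖(lam I - A)⁻¹ x‖`. -/
def PreExtrapolation (_hlam : lam ∈ resolventSet A) : Type _ := X

instance (hlam : lam ∈ resolventSet A) : AddCommGroup (PreExtrapolation hlam) :=
  inferInstanceAs (AddCommGroup X)

instance (hlam : lam ∈ resolventSet A) : Module 𝕜 (PreExtrapolation hlam) :=
  inferInstanceAs (Module 𝕜 X)

/-- The identity `X → (X, ‖·‖₋₁)`. -/
def toPre (hlam : lam ∈ resolventSet A) : X ≃ₗ[𝕜] PreExtrapolation hlam :=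
  LinearEquiv.refl 𝕜 X

/-- The resolvent as a map on `(X, ‖·‖₋₁)`. -/
def preResolvent (hlam : lam ∈ resolventSet A) : PreExtrapolation hlam →ₗ[𝕜] X :=
  (resolvent hlam).toLinearMap ∘ₗ (toPre hlam).symm.toLinearMap

theorem preResolvent_injective (hlam : lam ∈ resolventSet A) :
    Function.Injective (preResolvent hlam) :=
  (resolvent_injective hlam).comp (toPre hlam).symm.injective

instance (hlam : lam ∈ resolventSet A) : NormedAddCommGroup (PreExtrapolation hlam) :=
  NormedAddCommGroup.induced (PreExtrapolation hlam) X (preResolvent hlam)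
    (preResolvent_injective hlam)

instance (hlam : lam ∈ resolventSet A) : NormedSpace 𝕜 (PreExtrapolation hlam) :=
  NormedSpace.induced 𝕜 (PreExtrapolation hlam) X (preResolvent hlam)

/-- The norm on `(X, ‖·‖₋₁)` is `‖(lam I - A)⁻¹ x‖`. -/
theorem norm_toPre (hlam : lam ∈ resolventSet A) (x : X) :
    ‖toPre hlam x‖ = ‖resolvent hlam x‖ := rfl

/-- The extrapolation space `X₋₁`: the completion of `X` for `‖x‖₋₁ = ‖(lam I - A)⁻¹ x‖`. -/
abbrev Extrapolation (hlam : lam ∈ resolventSet A) : Type _ :=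
  UniformSpace.Completion (PreExtrapolation hlam)

instance (hlam : lam ∈ resolventSet A) : NormedSpace ℝ (Extrapolation hlam) :=
  NormedSpace.restrictScalars ℝ 𝕜 (Extrapolation hlam)

/-- The canonical embedding `X → X₋₁`. -/
def embed (hlam : lam ∈ resolventSet A) : X →ₗ[𝕜] Extrapolation hlam :=
  (UniformSpace.Completion.toComplL (𝕜 := 𝕜) (E := PreExtrapolation hlam)).toLinearMap ∘ₗ
    (toPre hlam).toLinearMap

/-- `T(t)` as a bounded operator on `(X, ‖·‖₋₁)`. -/
def preOp {T : C0Semigroup 𝕜 X} (hA : IsGenerator A T) (hlam : lam ∈ resolventSet A)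
    (t : ℝ≥0) : PreExtrapolation hlam →L[𝕜] PreExtrapolation hlam :=
  LinearMap.mkContinuous
    ((toPre hlam).toLinearMap ∘ₗ (T.op t).toLinearMap ∘ₗ (toPre hlam).symm.toLinearMap)
    ‖T.op t‖ (by
      intro x
      change ‖resolvent hlam (T.op t ((toPre hlam).symm x))‖ ≤
        ‖T.op t‖ * ‖resolvent hlam ((toPre hlam).symm x)‖
      rw [resolvent_comm hA]
      exact (T.op t).le_opNorm _)

/-- `T₋₁(t)`: the unique continuous extension of `T(t)` to `X₋₁`. -/
def extOp {T : C0Semigroup 𝕜 X} (hA : IsGenerator A T) (hlam : lam ∈ resolventSet A)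
    (t : ℝ≥0) : Extrapolation hlam →L[𝕜] Extrapolation hlam :=
  (preOp hA hlam t).completion

end Space

/-! ### Young functions, Orlicz spaces and input spaces -/

/-- `Φ` (restricted to `[0,∞)`) is a Young function. -/
def IsYoung (Φ : ℝ → ℝ) : Prop :=
  ∃ φ : ℝ → ℝ, φ 0 = 0 ∧ (∀ s, 0 < s → 0 < φ s) ∧ MonotoneOn φ (Ici 0) ∧
    (∀ s, 0 ≤ s → ContinuousWithinAt φ (Ici s) s) ∧ Tendsto φ atTop atTop ∧
    ∀ t, 0 ≤ t → Φ t = ∫ s in (0 : ℝ)..t, φ s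

/-- Lebesgue measure on the interval `(0,t)`. -/
def vol (t : ℝ≥0) : Measure ℝ := volume.restrict (Ioo 0 (t : ℝ))

section Inputs

variable {U : Type*} [NormedAddCommGroup U]

/-- The modular `∫₀ᵗ Φ(‖u(s)‖ / k) ds ∈ [0,∞]`. -/
def modular (Φ : ℝ → ℝ) (t k : ℝ≥0) (u : ℝ → U) : ℝ≥0∞ :=
  ∫⁻ s, ENNReal.ofReal (Φ ((k : ℝ)⁻¹ * ‖u s‖)) ∂(vol t)

/-- (Representatives of) elements of the Orlicz space `L_Φ(0,t;U)`. -/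
def MemOrlicz (Φ : ℝ → ℝ) (t : ℝ≥0) (u : ℝ → U) : Prop :=
  AEStronglyMeasurable u (vol t) ∧ ∃ k : ℝ≥0, 0 < k ∧ modular Φ t k u < ∞

/-- The Luxemburg norm on `L_Φ(0,t;U)`. -/
def luxemburg (Φ : ℝ → ℝ) (t : ℝ≥0) (u : ℝ → U) : ℝ≥0 :=
  sInf {k : ℝ≥0 | 0 < k ∧ modular Φ t k u ≤ 1}

/-- (Representatives of) elements of `E_Φ(0,t;U)`, the closure of `L^∞(0,t;U)` in
`L_Φ(0,t;U)`. -/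
def MemE (Φ : ℝ → ℝ) (t : ℝ≥0) (u : ℝ → U) : Prop :=
  MemOrlicz Φ t u ∧
    ∀ ε : ℝ≥0, 0 < ε → ∃ v : ℝ → U, MemLp v ∞ (vol t) ∧ luxemburg Φ t (u - v) < ε

end Inputs

/-- The families of input spaces `Z(0,t;U)`: Lebesgue spaces `L^p` (with `1 ≤ p ≤ ∞`) and
Orlicz spaces `E_Φ` (with `Φ` a Young function). -/
inductive InputSpace where
  | lebesgue (p : ℝ≥0∞)
  | orlicz (Φ : ℝ → ℝ)

/-- `u ∈ Z(0,t;U)`. -/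
def InputSpace.Mem {U : Type*} [NormedAddCommGroup U] (Z : InputSpace) (t : ℝ≥0)
    (u : ℝ → U) : Prop :=
  match Z with
  | .lebesgue p => MemLp u p (vol t)
  | .orlicz Φ => MemE Φ t u

/-- `‖u‖_{Z(0,t;U)}`. -/
def InputSpace.norm {U : Type*} [NormedAddCommGroup U] (Z : InputSpace) (t : ℝ≥0)
    (u : ℝ → U) : ℝ≥0 :=
  match Z with
  | .lebesgue p => (eLpNorm u p (vol t)).toNNReal
  | .orlicz Φ => luxemburg Φ t u

/-! ### Comparison functions -/

/-- The class `𝒦`. -/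
def ClassK (μ : ℝ≥0 → ℝ≥0) : Prop := μ 0 = 0 ∧ Continuous μ ∧ StrictMono μ

/-- The class `𝒦_∞`. -/
def ClassKInf (θ : ℝ≥0 → ℝ≥0) : Prop := ClassK θ ∧ Tendsto θ atTop atTop

/-- The class `ℒ`. -/
def ClassL (γ : ℝ≥0 → ℝ≥0) : Prop := Continuous γ ∧ StrictAnti γ ∧ Tendsto γ atTop (𝓝 0)

/-! ### Linear systems, admissibility and stability -/

/-- A linear system `Σ(A,B)`: `A` generates the `C₀`-semigroup `T` on `X`, and `B` is a bounded
operator from `U` to `X₋₁`, the latter formed with some `lam ∈ ρ(A)`. -/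
structure LinearSystem (𝕜 X U : Type*) [RCLike 𝕜] [NormedAddCommGroup X] [NormedSpace 𝕜 X]
    [NormedAddCommGroup U] [NormedSpace 𝕜 U] where
  A : X →ₗ.[𝕜] X
  T : C0Semigroup 𝕜 X
  generates : IsGenerator A T
  lam : 𝕜
  lam_mem : lam ∈ resolventSet A
  B : U →L[𝕜] Extrapolation lam_mem

namespace LinearSystem

variable {𝕜 X U : Type*} [RCLike 𝕜] [NormedAddCommGroup X] [NormedSpace 𝕜 X]
  [NormedAddCommGroup U] [NormedSpace 𝕜 U]

/-- The space `X₋₁` of the system. -/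
abbrev Xm1 (S : LinearSystem 𝕜 X U) : Type _ := Extrapolation S.lam_mem

/-- The embedding `X → X₋₁` of the system. -/
def emb (S : LinearSystem 𝕜 X U) : X →ₗ[𝕜] S.Xm1 := embed S.lam_mem

/-- The operator `T₋₁(t)` of the system. -/
def Tm1 (S : LinearSystem 𝕜 X U) (t : ℝ≥0) : S.Xm1 →L[𝕜] S.Xm1 :=
  extOp S.generates S.lam_mem t

/-- `∫₀ᵗ T₋₁(s) B u(s) ds`, a Bochner integral in `X₋₁`. -/
def inputIntegral (S : LinearSystem 𝕜 X U) (t : ℝ≥0) (u : ℝ → U) : S.Xm1 :=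
  ∫ s, S.Tm1 s.toNNReal (S.B (u s)) ∂(vol t)

/-- The mild solution `x(t) = T(t) x₀ + ∫₀ᵗ T₋₁(t - s) B u(s) ds`, with values in `X₋₁`. -/
def mildSolution (S : LinearSystem 𝕜 X U) (x₀ : X) (u : ℝ → U) (t : ℝ≥0) : S.Xm1 :=
  S.emb (S.T.op t x₀) + ∫ s, S.Tm1 ((t : ℝ) - s).toNNReal (S.B (u s)) ∂(vol t)

/-- Finite-time admissibility with respect to `Z`. -/
def Admissible (S : LinearSystem 𝕜 X U) (Z : InputSpace) : Prop :=
  ∀ t : ℝ≥0, 0 < t → ∀ u : ℝ → U, Z.Mem t u → ∃ z : X, S.emb z = S.inputIntegral t u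

/-- Infinite-time admissibility with respect to `Z`: the system is admissible, and the estimate
`‖∫₀ᵗ T₋₁(s) B u(s) ds‖_X ≤ c ‖u‖_{Z(0,t;U)}` holds with a constant independent of `t`. -/
def InfiniteTimeAdmissible (S : LinearSystem 𝕜 X U) (Z : InputSpace) : Prop :=
  S.Admissible Z ∧
    ∃ c : ℝ≥0, ∀ t : ℝ≥0, 0 < t → ∀ u : ℝ → U, Z.Mem t u →
      ∀ z : X, S.emb z = S.inputIntegral t u → ‖z‖₊ ≤ c * Z.norm t u

/-- Strong input-to-state stability with respect to `Z`. -/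
def IsSISS (S : LinearSystem 𝕜 X U) (Z : InputSpace) : Prop :=
  ∃ (μ : ℝ≥0 → ℝ≥0) (β : X → ℝ≥0 → ℝ≥0), ClassK μ ∧ (∀ x : X, x ≠ 0 → ClassL (β x)) ∧
    ∀ (t : ℝ≥0) (x₀ : X) (u : ℝ → U), Z.Mem t u →
      ∃ x : X, S.emb x = S.mildSolution x₀ u t ∧ ‖x‖₊ ≤ β x₀ t + μ (Z.norm t u)

/-- Strong integral input-to-state stability with respect to `Z`. The integral on the right of the
estimate, computed in `[0,∞]`, is required to be finite, so that `θ` can be applied to it. -/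
def IsSIISS (S : LinearSystem 𝕜 X U) (Z : InputSpace) : Prop :=
  ∃ (θ μ : ℝ≥0 → ℝ≥0) (β : X → ℝ≥0 → ℝ≥0), ClassKInf θ ∧ ClassK μ ∧
    (∀ x : X, x ≠ 0 → ClassL (β x)) ∧
    ∀ (t : ℝ≥0) (x₀ : X) (u : ℝ → U), Z.Mem t u →
      ∃ x : X, S.emb x = S.mildSolution x₀ u t ∧
        (∫⁻ s, (μ ‖u s‖₊ : ℝ≥0∞) ∂(vol t)) < ∞ ∧
        ‖x‖₊ ≤ β x₀ t + θ (∫⁻ s, (μ ‖u s‖₊ : ℝ≥0∞) ∂(vol t)).toNNReal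

end LinearSystem

end StrongISS

end

namespace StrongISS

/-! ### Comparison functions -/

/-! The equivalence rests on linearity. Zero input turns the sISS estimate into a bound on orbits,
which gives strong stability. The reflection `s ↦ t - s` turns the forced part of the mild solution
into the input integral. The estimate bounds that integral on the unit ball uniformly in time, and
homogeneity makes the bound linear. Conversely, each orbit is continuous and tends to zero, so it
has a majorant in `ClassL` (`exists_classL_ge`), to which admissibility adds a linear gain.

For the integral estimate, the Luxemburg norm must be controlled by `a = ∫ ν(‖u‖)` for one `ν` of
class 𝒦. Since `Φ` may grow arbitrarily fast, `ν = Φ` does not suffice: a small modular need not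
make the norm small. A series `ν` dominating every dilate `Φ((n+1)·)` up to a factor `C n`
(`ClassK.exists_classK_dominating`) does. The modular at scale `1/(n+1)` is then at most `C n * a`,
so convexity bounds the norm by `(1 + C n * a)/(n+1)`. The infimum over `n` is continuous in `a` and
vanishes at zero, so composing the sISS gain with it yields `θ`. -/

theorem classL_inv_one_add : ClassL fun t : ℝ≥0 => (1 + t)⁻¹ := by
  refine ⟨Continuous.inv₀ (by fun_prop) fun t => by positivity, fun t t' h => ?_, ?_⟩
  · have h' : 1 + t < 1 + t' := add_lt_add_right h 1
    exact inv_strictAnti₀ (by positivity) h'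
  · have h1 : Tendsto (fun t : ℝ≥0 => 1 + t) atTop atTop :=
      tendsto_atTop_mono (fun t => le_add_self) tendsto_id
    exact tendsto_inv_atTop_zero.comp h1

theorem exists_classL_ge {f : ℝ≥0 → ℝ≥0} (hf : Continuous f) (h0 : Tendsto f atTop (𝓝 0)) :
    ∃ γ, ClassL γ ∧ ∀ t, f t ≤ γ t := by
  obtain ⟨M, hM⟩ : ∃ M, ∀ s, f s ≤ M := by
    obtain ⟨T, hT⟩ := eventually_atTop.1 (h0.eventually_le_const zero_lt_one)
    obtain ⟨M, hM⟩ := (isCompact_Icc (a := 0) (b := T)).bddAbove_image hf.continuousOn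
    refine ⟨max M 1, fun s => ?_⟩
    rcases le_total s T with hs | hs
    · exact le_max_of_le_left (hM (mem_image_of_mem f ⟨zero_le, hs⟩))
    · exact le_max_of_le_right (hT s hs)
  have hbdd : ∀ t, BddAbove (range fun s => f s - (t - s)) := fun t =>
    ⟨M, by rintro _ ⟨s, rfl⟩; exact tsub_le_self.trans (hM s)⟩
  -- A sup-convolution with truncated subtraction: there is no penalty for `s ≥ t` and slope one for
  -- `s < t`. Hence `g` is antitone, 1-Lipschitz and above `f`.
  set g : ℝ≥0 → ℝ≥0 := fun t => ⨆ s, (f s - (t - s))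
  have hfg : ∀ t, f t ≤ g t := fun t => by
    simpa using le_ciSup (hbdd t) t
  have hlip : ∀ t t', g t ≤ g t' + (t' - t) := fun t t' => by
    refine ciSup_le fun s => ?_
    have h1 : f s - (t' - s) ≤ g t' := le_ciSup (hbdd t') s
    have h2 : t' - s ≤ (t - s) + (t' - t) := by
      rw [add_comm]; exact tsub_le_tsub_add_tsub
    rw [tsub_le_iff_right]
    calc f s ≤ g t' + (t' - s) := tsub_le_iff_right.1 h1
      _ ≤ g t' + ((t - s) + (t' - t)) := by gcongr
      _ = _ := by ring
  have hanti : Antitone g := fun t t' h => by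
    simpa [tsub_eq_zero_of_le h] using hlip t' t
  have hcont : Continuous g := by
    have : LipschitzWith 1 fun t => (g t : ℝ) := by
      refine LipschitzWith.of_le_add fun t t' => ?_
      have h1 : (g t : ℝ) ≤ g t' + (t' - t : ℝ≥0) := by exact_mod_cast hlip t t'
      refine h1.trans (add_le_add le_rfl ?_)
      rw [NNReal.dist_eq, NNReal.coe_sub_def, abs_sub_comm]
      exact max_le (le_abs_self _) (abs_nonneg _)
    exact continuous_induced_rng.2 this.continuous
  have hlim : Tendsto g atTop (𝓝 0) := by
    refine tendsto_order.2 ⟨fun a ha => (not_lt_zero ha).elim, fun ε hε => ?_⟩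
    obtain ⟨δ, hδ, hδε⟩ := exists_between hε
    obtain ⟨T, hT⟩ := eventually_atTop.1 (h0.eventually_le_const hδ)
    filter_upwards [eventually_ge_atTop (M + T)] with t ht
    refine lt_of_le_of_lt (ciSup_le fun s => ?_) hδε
    -- Late `s` contribute at most `δ`; for early `s` the penalty `t - s` exceeds the global bound
    -- `M`, so the truncated difference is zero.
    rcases le_total T s with hs | hs
    · exact tsub_le_self.trans (hT s hs)
    · have : f s ≤ t - s := (hM s).trans (le_tsub_of_add_le_right ((by gcongr : M + s ≤ M + T).trans ht))
      rw [tsub_eq_zero_of_le this]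
      exact zero_le
  obtain ⟨hic, hia, hil⟩ := classL_inv_one_add
  -- The extra summand makes the antitone `g` strictly decreasing.
  refine ⟨fun t => g t + (1 + t)⁻¹, ⟨hcont.add hic, fun t t' h => ?_, ?_⟩,
    fun t => (hfg t).trans le_self_add⟩
  · exact add_lt_add_of_le_of_lt (hanti h.le) (hia h)
  · simpa using hlim.add hil

/-- Take `μ s = ∑ 2⁻ⁿ Ψ((n+1)s) / Ψ((n+1)²)`. Once `n + 1 ≥ s` the quotient is at most one, so the
series converges; keeping only the `n`-th term gives the domination. -/
theorem ClassK.exists_classK_dominating {Ψ : ℝ≥0 → ℝ≥0} (hΨ : ClassK Ψ) :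
    ∃ (μ : ℝ≥0 → ℝ≥0) (C : ℕ → ℝ≥0), ClassK μ ∧ ∀ (n : ℕ) (s : ℝ≥0), Ψ ((n + 1) * s) ≤ C n * μ s := by
  obtain ⟨h0, hc, hm⟩ := hΨ
  have hpos : ∀ s, 0 < s → 0 < Ψ s := fun s hs => by simpa [h0] using hm hs
  set D : ℕ → ℝ≥0 := fun n => Ψ ((n + 1) * (n + 1))
  have hD : ∀ n, 0 < D n := fun n => hpos _ (by positivity)
  set F : ℕ → ℝ≥0 → ℝ≥0 := fun n s => (1 / 2) ^ n * (Ψ ((n + 1) * s) / D n) with hF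
  have hFmono : ∀ n, Monotone (F n) := fun n s s' h => by
    have := hm.monotone (mul_le_mul_of_nonneg_left h (zero_le (a := (n + 1 : ℝ≥0))))
    simp only [hF]
    gcongr
  have hgeo : Summable fun n : ℕ => ((1 / 2 : ℝ≥0)) ^ n :=
    NNReal.summable_geometric (by rw [div_lt_one two_pos]; exact one_lt_two)
  have hFsum : ∀ s, Summable fun n => F n s := fun s => by
    obtain ⟨N, hN⟩ := exists_nat_ge s
    rw [← NNReal.summable_nat_add_iff N]
    refine NNReal.summable_of_le (fun n => ?_) ((NNReal.summable_nat_add_iff N).2 hgeo)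
    have hs : s ≤ ((n + N : ℕ) : ℝ≥0) + 1 := by
      push_cast
      exact hN.trans (le_add_right (le_add_left le_rfl))
    exact mul_le_of_le_one_right zero_le ((div_le_one (hD _)).2 (hm.monotone (by gcongr)))
  refine ⟨fun s => ∑' n, F n s, fun n => 2 ^ n * D n, ⟨?_, ?_, ?_⟩, fun n s => ?_⟩
  · simp [hF, h0]
  · refine continuous_iff_continuousAt.2 fun s => NNReal.tendsto_coe.1 ?_
    -- Weierstrass test on `[0, s + 1)`: by monotonicity the values at `s + 1` are a summable
    -- majorant.
    have h1 : ContinuousOn (fun x => ∑' n, (F n x : ℝ)) (Iio (s + 1)) := by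
      refine continuousOn_tsum (u := fun n => (F n (s + 1) : ℝ)) (fun n => ?_)
        (NNReal.summable_coe.2 (hFsum _)) fun n x hx => ?_
      · refine Continuous.continuousOn ?_
        simp only [hF]
        fun_prop
      · simpa using hFmono n (le_of_lt hx)
    simpa only [ContinuousAt, NNReal.coe_tsum] using
      h1.continuousAt (Iio_mem_nhds (lt_add_of_pos_right s one_pos))
  · intro s s' h
    refine NNReal.tsum_lt_tsum (i := 0) (fun n => hFmono n h.le) ?_ (hFsum s')
    have := hm h
    have := hD 0
    simp only [hF, pow_zero, one_mul, Nat.cast_zero, zero_add]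
    gcongr
  · have h1 : F n s ≤ ∑' n, F n s := (hFsum s).le_tsum n fun _ _ => zero_le
    calc Ψ ((n + 1) * s) = 2 ^ n * D n * F n s := by
          simp only [hF, one_div, inv_pow]
          have := (hD n).ne'
          field_simp
      _ ≤ _ := by gcongr

theorem iInf_affine_div_zero (C : ℕ → ℝ≥0) :
    ⨅ n : ℕ, (1 + C n * 0) / (n + 1 : ℝ≥0) = 0 := by
  refine le_antisymm (le_of_forall_pos_le_add fun ε hε => ?_) zero_le
  obtain ⟨n, hn⟩ := exists_nat_one_div_lt hε
  rw [zero_add]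
  exact (ciInf_le' _ n).trans (by simpa using hn.le)

/-- An infimum of continuous functions is only upper semicontinuous in general. Away from zero, the
comparison `1 + C b ≤ max 1 (b/a) (1 + C a)` is uniform in `C` and passes to the infimum, squeezing
it from both sides. At zero the value is zero, so upper semicontinuity is enough. -/
theorem continuous_iInf_affine_div (C : ℕ → ℝ≥0) :
    Continuous fun a : ℝ≥0 => ⨅ n : ℕ, (1 + C n * a) / (n + 1 : ℝ≥0) := by
  set h : ℝ≥0 → ℝ≥0 := fun a => ⨅ n : ℕ, (1 + C n * a) / (n + 1 : ℝ≥0)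
  have hle : ∀ a n, h a ≤ (1 + C n * a) / (n + 1 : ℝ≥0) := fun a n => ciInf_le' _ n
  have hzero : h 0 = 0 := iInf_affine_div_zero C
  have hkey : ∀ a b, 0 < a → h b ≤ max 1 (b / a) * h a := fun a b ha => by
    rw [NNReal.mul_iInf]
    refine le_ciInf fun n => (hle b n).trans ?_
    rw [← mul_div_assoc, mul_add, mul_one]
    refine div_le_div_of_nonneg_right (add_le_add (le_max_left _ _) ?_) zero_le
    calc C n * b = b / a * (C n * a) := by field_simp
      _ ≤ _ := by gcongr; exact le_max_right _ _
  refine continuous_iff_continuousAt.2 fun a => ?_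
  rcases eq_zero_or_pos a with rfl | ha
  · rw [ContinuousAt, hzero]
    refine tendsto_order.2 ⟨fun a ha => (not_lt_zero ha).elim, fun ε hε => ?_⟩
    obtain ⟨n, hn⟩ := exists_nat_one_div_lt hε
    have hc : Continuous fun a : ℝ≥0 => (1 + C n * a) / (n + 1 : ℝ≥0) := by fun_prop
    filter_upwards [(hc.tendsto 0).eventually_lt_const (by simpa using hn)] with b hb
    exact (hle b n).trans_lt hb
  · have hU : Tendsto (fun b => max 1 (b / a) * h a) (𝓝 a) (𝓝 (h a)) := by
      have hc : Continuous fun b : ℝ≥0 => max 1 (b / a) * h a := by fun_prop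
      simpa [div_self ha.ne'] using hc.tendsto a
    have hL : Tendsto (fun b => h a / max 1 (a / b)) (𝓝 a) (𝓝 (h a)) := by
      have hc : ContinuousAt (fun b : ℝ≥0 => h a / max 1 (a / b)) a :=
        continuousAt_const.div₀
          (continuousAt_const.max (continuousAt_const.div₀ continuousAt_id ha.ne'))
          (lt_max_of_lt_left one_pos).ne'
      simpa [ContinuousAt, div_self ha.ne'] using hc
    refine tendsto_of_tendsto_of_tendsto_of_le_of_le' hL hU ?_
      (Eventually.of_forall fun b => hkey a b ha)
    filter_upwards [lt_mem_nhds ha] with b hb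
    rw [div_le_iff₀ (lt_max_of_lt_left one_pos), mul_comm]
    exact hkey b a hb

theorem monotone_iInf_affine_div (C : ℕ → ℝ≥0) :
    Monotone fun a : ℝ≥0 => ⨅ n : ℕ, (1 + C n * a) / (n + 1 : ℝ≥0) := fun a b hab =>
  le_ciInf fun n => (ciInf_le' _ n).trans (by gcongr)

/-! ### Young functions -/

namespace IsYoung

variable {Φ : ℝ → ℝ}

theorem classK_toNNReal (hΦ : IsYoung Φ) : ClassK fun s : ℝ≥0 => (Φ s).toNNReal := by
  obtain ⟨φ, -, hpos, hmono, -, -, hint⟩ := hΦ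
  have hii : ∀ {a b : ℝ}, 0 ≤ a → 0 ≤ b → IntervalIntegrable φ volume a b := fun ha hb =>
    (hmono.mono fun x hx => (le_min ha hb).trans hx.1).intervalIntegrable
  have h0 : Φ 0 = 0 := by simp [hint 0 le_rfl]
  have hlt : ∀ s s' : ℝ≥0, s < s' → Φ s < Φ s' := fun s s' h => by
    rw [hint s s.coe_nonneg, hint s' s'.coe_nonneg,
      ← intervalIntegral.integral_add_adjacent_intervals (hii le_rfl s.coe_nonneg) (hii s.coe_nonneg s'.coe_nonneg)]
    exact lt_add_of_pos_right _ (intervalIntegral.intervalIntegral_pos_of_pos_on (hii s.coe_nonneg s'.coe_nonneg)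
      (fun x hx => hpos x (s.coe_nonneg.trans_lt hx.1)) h)
  refine ⟨by simp [h0], ?_, fun s s' h => ?_⟩
  · refine continuous_real_toNNReal.comp (continuous_iff_continuousAt.2 fun s => ?_)
    have hs : (0 : ℝ) ≤ s + 1 := by positivity
    have h1 : ContinuousOn (fun x => ∫ r in (0 : ℝ)..x, φ r) (uIcc 0 (s + 1 : ℝ)) :=
      intervalIntegral.continuousOn_primitive_interval' (hii le_rfl hs) left_mem_uIcc
    have h2 : ContinuousOn (fun x : ℝ≥0 => ∫ r in (0 : ℝ)..x, φ r) (Iio (s + 1)) := by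
      refine h1.comp NNReal.continuous_coe.continuousOn fun x hx => ?_
      rw [uIcc_of_le hs]
      exact ⟨x.coe_nonneg, by exact_mod_cast (mem_Iio.1 hx).le⟩
    simpa only [← hint _ (NNReal.coe_nonneg _)] using
      h2.continuousAt (Iio_mem_nhds (lt_add_of_pos_right s one_pos))
  · have h2 : 0 ≤ Φ s := by
      rcases eq_zero_or_pos s with rfl | hs
      · simp [h0]
      · simpa [h0] using (hlt 0 s hs).le
    exact (Real.toNNReal_lt_toNNReal_iff_of_nonneg h2).2 (hlt s s' h)

/-- The consequence of convexity that is needed: substitution gives `Φ(cs) = c ∫₀ˢ φ(cr) dr`, and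
`φ(cr) ≤ φ(r)`. -/
theorem toNNReal_mul_le (hΦ : IsYoung Φ) {c : ℝ≥0} (hc : c ≤ 1) (s : ℝ≥0) :
    (Φ (c * s)).toNNReal ≤ c * (Φ s).toNNReal := by
  obtain ⟨φ, -, -, hmono, -, -, hint⟩ := hΦ
  have hc' : (c : ℝ) ≤ 1 := hc
  have hle : ∀ x ∈ Icc (0 : ℝ) s, φ (c * x) ≤ φ x := fun x hx =>
    hmono (mul_nonneg c.coe_nonneg hx.1) hx.1 (mul_le_of_le_one_left hx.1 hc')
  have h1 : Φ (c * s) ≤ c * Φ s := by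
    rw [hint _ (by positivity), hint _ s.coe_nonneg]
    have := intervalIntegral.mul_integral_comp_mul_left (a := 0) (b := (s : ℝ)) (f := φ) (c : ℝ)
    rw [mul_zero] at this
    rw [← this]
    refine mul_le_mul_of_nonneg_left (intervalIntegral.integral_mono_on s.coe_nonneg ?_ ?_ hle) c.coe_nonneg
    · refine MonotoneOn.intervalIntegrable fun x hx y hy hxy => ?_
      rw [uIcc_of_le s.coe_nonneg] at hx hy
      exact hmono (mul_nonneg c.coe_nonneg hx.1) (mul_nonneg c.coe_nonneg hy.1) (mul_le_mul_of_nonneg_left hxy c.coe_nonneg)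
    · refine (hmono.mono fun x hx => ?_).intervalIntegrable
      rw [uIcc_of_le s.coe_nonneg] at hx
      exact hx.1
  calc (Φ (c * s)).toNNReal ≤ (c * Φ s).toNNReal := Real.toNNReal_le_toNNReal h1
    _ = c * (Φ s).toNNReal := by rw [Real.toNNReal_mul c.coe_nonneg, Real.toNNReal_coe]

end IsYoung

/-! ### Orlicz spaces -/

section Inputs

variable {U : Type*} [NormedAddCommGroup U] {Φ : ℝ → ℝ} {t : ℝ≥0} {u : ℝ → U}

instance (t : ℝ≥0) : IsFiniteMeasure (vol t) :=
  inferInstanceAs (IsFiniteMeasure (volume.restrict (Ioo 0 (t : ℝ))))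

theorem vol_zero : vol 0 = 0 := by simp [vol]

theorem modular_eq (Φ : ℝ → ℝ) (t k : ℝ≥0) (u : ℝ → U) :
    modular Φ t k u = ∫⁻ s, ((Φ ((k⁻¹ * ‖u s‖₊ : ℝ≥0) : ℝ)).toNNReal : ℝ≥0∞) ∂(vol t) := by
  simp [modular, ENNReal.ofReal]

theorem modular_mul_le (hΦ : IsYoung Φ) {K : ℝ≥0} (hK : 1 ≤ K) (k : ℝ≥0) :
    modular Φ t (K * k) u ≤ (K⁻¹ : ℝ≥0) * modular Φ t k u := by
  rw [modular_eq, modular_eq, ← lintegral_const_mul' _ _ ENNReal.coe_ne_top]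
  refine lintegral_mono fun s => ?_
  rw [mul_inv, mul_assoc]
  exact ENNReal.coe_le_coe.2 (hΦ.toNNReal_mul_le (inv_le_one_of_one_le₀ hK) _)

theorem luxemburg_le {k : ℝ≥0} (hk : 0 < k) (h : modular Φ t k u ≤ 1) : luxemburg Φ t u ≤ k :=
  csInf_le' ⟨hk, h⟩

/-- Ensures that the infimum defining the norm runs over a nonempty set, so it is not the default
value zero. -/
theorem MemOrlicz.exists_modular_le_one (hΦ : IsYoung Φ) (hu : MemOrlicz Φ t u) :
    ∃ k : ℝ≥0, 0 < k ∧ modular Φ t k u ≤ 1 := by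
  obtain ⟨-, k, hk, hfin⟩ := hu
  lift modular Φ t k u to ℝ≥0 using hfin.ne with m hm
  have hK : 1 ≤ 1 + m := le_self_add
  refine ⟨(1 + m) * k, by positivity, (modular_mul_le hΦ hK k).trans ?_⟩
  rw [← hm]
  norm_cast
  rw [inv_mul_le_iff₀ (by positivity), mul_one]
  exact le_add_self

theorem luxemburg_zero (hΦ : IsYoung Φ) : luxemburg Φ t (0 : ℝ → U) = 0 := by
  refine le_antisymm (le_of_forall_pos_le_add fun ε hε => ?_) zero_le
  rw [zero_add]
  refine luxemburg_le hε ?_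
  have h0 : (Φ 0).toNNReal = 0 := hΦ.classK_toNNReal.1
  simp [modular_eq, h0]

theorem lintegral_comp_nnnorm_lt_top {μ : ℝ≥0 → ℝ≥0} (hμ : Monotone μ)
    (hu : MemLp u ∞ (vol t)) : ∫⁻ s, (μ ‖u s‖₊ : ℝ≥0∞) ∂(vol t) < ∞ := by
  have hfin := hu.2
  rw [eLpNorm_exponent_top] at hfin
  lift eLpNormEssSup u (vol t) to ℝ≥0 using hfin.ne with M hM
  have hle : ∀ᵐ s ∂(vol t), ‖u s‖₊ ≤ M := by
    filter_upwards [enorm_ae_le_eLpNormEssSup u (vol t)] with s hs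
    rw [← hM] at hs
    exact ENNReal.coe_le_coe.1 hs
  calc ∫⁻ s, (μ ‖u s‖₊ : ℝ≥0∞) ∂(vol t) ≤ ∫⁻ _, (μ M : ℝ≥0∞) ∂(vol t) :=
        lintegral_mono_ae (hle.mono fun s hs => ENNReal.coe_le_coe.2 (hμ hs))
    _ < ∞ := by
        rw [lintegral_const]
        exact ENNReal.mul_lt_top ENNReal.coe_lt_top (measure_lt_top _ _)

theorem memE_of_memLp_top (hΦ : IsYoung Φ) (hu : MemLp u ∞ (vol t)) : MemE Φ t u := by
  refine ⟨⟨hu.1, 1, one_pos, ?_⟩, fun ε hε => ⟨u, hu, ?_⟩⟩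
  · simpa [modular_eq] using
      lintegral_comp_nnnorm_lt_top hΦ.classK_toNNReal.2.2.monotone hu
  · rwa [sub_self, luxemburg_zero hΦ]

/-- An integral condition on `u` bounds its Luxemburg norm. -/
theorem luxemburg_le_of_dominating (hΦ : IsYoung Φ) {μ : ℝ≥0 → ℝ≥0} {n : ℕ} {C : ℝ≥0}
    (hC : ∀ s : ℝ≥0, (Φ ((n + 1) * s : ℝ≥0)).toNNReal ≤ C * μ s)
    (hfin : ∫⁻ s, (μ ‖u s‖₊ : ℝ≥0∞) ∂(vol t) < ∞) :
    luxemburg Φ t u ≤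
      (1 + C * (∫⁻ s, (μ ‖u s‖₊ : ℝ≥0∞) ∂(vol t)).toNNReal) / (n + 1 : ℝ≥0) := by
  lift ∫⁻ s, (μ ‖u s‖₊ : ℝ≥0∞) ∂(vol t) to ℝ≥0 using hfin.ne with a ha
  rw [ENNReal.toNNReal_coe, div_eq_mul_inv]
  -- Enlarging the scale `1/(n+1)` by the factor `1 + C * a` divides the modular, at most `C * a`,
  -- by that factor, which brings it below one.
  have hK : 1 ≤ 1 + C * a := le_self_add
  refine luxemburg_le (by positivity) ((modular_mul_le hΦ hK _).trans ?_)
  have h1 : modular Φ t ((n : ℝ≥0) + 1)⁻¹ u ≤ ((C * a : ℝ≥0) : ℝ≥0∞) := by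
    rw [modular_eq, ENNReal.coe_mul, ha, ← lintegral_const_mul' _ _ ENNReal.coe_ne_top]
    refine lintegral_mono fun s => ?_
    rw [inv_inv]
    exact ENNReal.coe_le_coe.2 (hC ‖u s‖₊)
  refine (mul_le_mul_right h1 _).trans ?_
  norm_cast
  rw [inv_mul_le_iff₀ (by positivity), mul_one]
  exact le_add_self

section Smul

variable {𝕜 : Type*} [RCLike 𝕜] [NormedSpace 𝕜 U]

theorem modular_smul {c : 𝕜} (hc : c ≠ 0) (k : ℝ≥0) (u : ℝ → U) :
    modular Φ t (‖c‖₊ * k) (c • u) = modular Φ t k u := by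
  have hc' : ‖c‖₊ ≠ 0 := by simpa using hc
  simp only [modular_eq, Pi.smul_apply, nnnorm_smul]
  congr! 6 with s
  field_simp

theorem luxemburg_smul_le {c : 𝕜} (hc : c ≠ 0) (u : ℝ → U) :
    luxemburg Φ t (c • u) ≤ ‖c‖₊ * luxemburg Φ t u := by
  have hc' : 0 < ‖c‖₊ := by simpa [pos_iff_ne_zero] using hc
  by_cases h : {k : ℝ≥0 | 0 < k ∧ modular Φ t k u ≤ 1}.Nonempty
  · rw [mul_comm, ← div_le_iff₀ hc']
    refine le_csInf h fun k hk => ?_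
    rw [div_le_iff₀ hc', mul_comm]
    exact luxemburg_le (mul_pos hc' hk.1) ((modular_smul hc k u).trans_le hk.2)
  · have h' : {k : ℝ≥0 | 0 < k ∧ modular Φ t k (c • u) ≤ 1} = ∅ := by
      refine eq_empty_of_forall_notMem fun k hk => h ⟨‖c‖₊⁻¹ * k, ?_, ?_⟩
      · exact mul_pos (inv_pos.2 hc') hk.1
      · rw [← modular_smul hc, mul_inv_cancel_left₀ hc'.ne']
        exact hk.2
    -- With no admissible scale, the infimum over the empty set is zero.
    rw [luxemburg, h', NNReal.sInf_empty]
    exact zero_le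

theorem MemE.const_smul (hu : MemE Φ t u) {c : 𝕜} (hc : c ≠ 0) : MemE Φ t (c • u) := by
  have hc' : 0 < ‖c‖₊ := by simpa [pos_iff_ne_zero] using hc
  obtain ⟨⟨hm, k, hk, hfin⟩, happ⟩ := hu
  refine ⟨⟨hm.const_smul c, ‖c‖₊ * k, mul_pos hc' hk, ?_⟩, fun ε hε => ?_⟩
  · rwa [modular_smul hc]
  · obtain ⟨v, hv, hlt⟩ := happ (ε / ‖c‖₊) (div_pos hε hc')
    refine ⟨c • v, hv.const_smul c, ?_⟩
    rw [← smul_sub]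
    refine (luxemburg_smul_le hc _).trans_lt ?_
    rwa [mul_comm, ← lt_div_iff₀ hc']

end Smul

/-! ### Time reflection -/

theorem measurePreserving_reflect (t : ℝ≥0) :
    MeasurePreserving (fun s : ℝ => (t : ℝ) - s) (vol t) (vol t) := by
  have h := (Measure.measurePreserving_sub_left (volume : Measure ℝ) (t : ℝ)).restrict_preimage
    (measurableSet_Ioo (a := (0 : ℝ)) (b := (t : ℝ)))
  simpa [vol] using h

theorem measurableEmbedding_reflect (t : ℝ≥0) :
    MeasurableEmbedding (fun s : ℝ => (t : ℝ) - s) :=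
  (MeasurableEquiv.subLeft (t : ℝ)).measurableEmbedding

/-- The input `s ↦ u(t - s)`. -/
def reflect (t : ℝ≥0) (u : ℝ → U) : ℝ → U := fun s => u ((t : ℝ) - s)

theorem reflect_reflect {V : Type*} (t : ℝ≥0) (u : ℝ → V) : reflect t (reflect t u) = u := by
  ext s; simp [reflect]

theorem modular_reflect (k : ℝ≥0) (u : ℝ → U) :
    modular Φ t k (reflect t u) = modular Φ t k u :=
  (measurePreserving_reflect t).lintegral_comp_emb (measurableEmbedding_reflect t)
    fun s => ENNReal.ofReal (Φ ((k : ℝ)⁻¹ * ‖u s‖))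

theorem luxemburg_reflect (u : ℝ → U) : luxemburg Φ t (reflect t u) = luxemburg Φ t u := by
  simp only [luxemburg, modular_reflect]

theorem MemE.reflect (hu : MemE Φ t u) : MemE Φ t (reflect t u) := by
  obtain ⟨⟨hm, k, hk, hfin⟩, happ⟩ := hu
  refine ⟨⟨hm.comp_measurePreserving (measurePreserving_reflect t), k, hk, ?_⟩, fun ε hε => ?_⟩
  · rwa [modular_reflect]
  · obtain ⟨v, hv, hlt⟩ := happ ε hε
    refine ⟨StrongISS.reflect t v, hv.comp_measurePreserving (measurePreserving_reflect t), ?_⟩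
    rwa [← luxemburg_reflect] at hlt

end Inputs

/-! ### Linear systems -/

namespace LinearSystem

variable {𝕜 X U : Type*} [RCLike 𝕜] [NormedAddCommGroup X] [NormedSpace 𝕜 X]
  [NormedAddCommGroup U] [NormedSpace 𝕜 U] {S : LinearSystem 𝕜 X U} {Φ : ℝ → ℝ}

theorem emb_injective (S : LinearSystem 𝕜 X U) : Function.Injective S.emb := fun _ _ h =>
  (toPre S.lam_mem).injective (UniformSpace.Completion.coe_injective _ h)

theorem inputIntegral_zero (S : LinearSystem 𝕜 X U) (t : ℝ≥0) : S.inputIntegral t 0 = 0 := by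
  simp [inputIntegral]

theorem inputIntegral_smul (S : LinearSystem 𝕜 X U) (t : ℝ≥0) (r : ℝ) (u : ℝ → U) :
    S.inputIntegral t ((r : 𝕜) • u) = (r : 𝕜) • S.inputIntegral t u := by
  simp only [inputIntegral, Pi.smul_apply, map_smul]
  exact integral_smul r _

theorem mildSolution_eq (S : LinearSystem 𝕜 X U) (x₀ : X) (u : ℝ → U) (t : ℝ≥0) :
    S.mildSolution x₀ u t = S.emb (S.T.op t x₀) + S.inputIntegral t (reflect t u) := by
  rw [mildSolution, inputIntegral, ← (measurePreserving_reflect t).integral_comp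
    (measurableEmbedding_reflect t)]
  simp [reflect]

theorem mildSolution_reflect (S : LinearSystem 𝕜 X U) (x₀ : X) (u : ℝ → U) (t : ℝ≥0) :
    S.mildSolution x₀ (reflect t u) t = S.emb (S.T.op t x₀) + S.inputIntegral t u := by
  rw [mildSolution_eq, reflect_reflect]

/-- The orbit of `x₀` is the mild solution with zero input. -/
theorem mildSolution_zero (S : LinearSystem 𝕜 X U) (x₀ : X) (t : ℝ≥0) :
    S.mildSolution x₀ 0 t = S.emb (S.T.op t x₀) := by
  have h : reflect t (0 : ℝ → U) = 0 := rfl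
  rw [mildSolution_eq, h, inputIntegral_zero, add_zero]

theorem nnnorm_op_le_of_estimate (hΦ : IsYoung Φ) {μ : ℝ≥0 → ℝ≥0} {β : X → ℝ≥0 → ℝ≥0}
    (hμ : ClassK μ)
    (h : ∀ (t : ℝ≥0) (x₀ : X) (u : ℝ → U), MemE Φ t u →
      ∃ x : X, S.emb x = S.mildSolution x₀ u t ∧ ‖x‖₊ ≤ β x₀ t + μ (luxemburg Φ t u))
    (t : ℝ≥0) (x₀ : X) : ‖S.T.op t x₀‖₊ ≤ β x₀ t := by
  obtain ⟨x, hx, hle⟩ := h t x₀ 0 (memE_of_memLp_top hΦ MemLp.zero)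
  rw [mildSolution_zero] at hx
  rw [luxemburg_zero hΦ, hμ.1, add_zero] at hle
  rwa [← S.emb_injective hx]

theorem stronglyStable_of_isSISS (hΦ : IsYoung Φ) (h : S.IsSISS (.orlicz Φ)) :
    S.T.StronglyStable := by
  obtain ⟨μ, β, hμ, hβ, h⟩ := h
  intro x
  rcases eq_or_ne x 0 with rfl | hx
  · simp
  · refine squeeze_zero_norm (a := fun t => (β x t : ℝ)) (fun t => ?_) ?_
    · exact nnnorm_op_le_of_estimate hΦ hμ h t x
    · exact NNReal.tendsto_coe.2 (hβ x hx).2.2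

theorem infiniteTimeAdmissible_of_isSISS (hΦ : IsYoung Φ) (h : S.IsSISS (.orlicz Φ)) :
    S.InfiniteTimeAdmissible (.orlicz Φ) := by
  obtain ⟨μ, β, hμ, hβ, h⟩ := h
  refine ⟨fun t _ u hu => ?_, ?_⟩
  · obtain ⟨x, hx, -⟩ := h t 0 (reflect t u) (MemE.reflect hu)
    exact ⟨x, by rw [hx, mildSolution_reflect, map_zero, map_zero, zero_add]⟩
  rcases subsingleton_or_nontrivial X with hX | hX
  · exact ⟨0, fun t _ u _ z _ => by simp [Subsingleton.elim z 0]⟩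
  -- Nothing is assumed on `β 0`, which may be unbounded in time. A nonzero initial value is used
  -- instead, and its orbit is subtracted afterwards.
  obtain ⟨x₀, hx₀⟩ := exists_ne (0 : X)
  have hunit : ∀ (t : ℝ≥0) (v : ℝ → U), MemE Φ t v → luxemburg Φ t v ≤ 1 →
      ∀ z : X, S.emb z = S.inputIntegral t v → ‖z‖₊ ≤ 2 * β x₀ 0 + μ 1 := by
    intro t v hv hv1 z hz
    obtain ⟨x, hx, hle⟩ := h t x₀ (reflect t v) (MemE.reflect hv)
    rw [mildSolution_reflect, ← hz, ← map_add] at hx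
    have hx' := S.emb_injective hx
    have hop := nnnorm_op_le_of_estimate hΦ hμ h t x₀
    have hβ0 : β x₀ t ≤ β x₀ 0 := (hβ x₀ hx₀).2.1.antitone zero_le
    have hμ1 : μ (luxemburg Φ t (reflect t v)) ≤ μ 1 :=
      hμ.2.2.monotone ((luxemburg_reflect v).trans_le hv1)
    calc ‖z‖₊ = ‖x - S.T.op t x₀‖₊ := by rw [hx', add_sub_cancel_left]
      _ ≤ ‖x‖₊ + ‖S.T.op t x₀‖₊ := nnnorm_sub_le _ _
      _ ≤ (β x₀ 0 + μ 1) + β x₀ 0 := by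
        gcongr
        · exact hle.trans (add_le_add hβ0 hμ1)
        · exact hop.trans hβ0
      _ = _ := by ring
  refine ⟨2 * β x₀ 0 + μ 1, fun t _ u hu z hz => ?_⟩
  set C := 2 * β x₀ 0 + μ 1
  -- Scaling by any `k` with modular at most one, rather than by the norm itself, avoids dividing by
  -- a zero norm and any need for the infimum to be attained.
  have hbound : ∀ k : ℝ≥0, 0 < k → modular Φ t k u ≤ 1 → ‖z‖₊ ≤ C * k := by
    intro k hk hmod
    have hk𝕜 : (((k : ℝ)⁻¹ : ℝ) : 𝕜) ≠ 0 := by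
      simpa using hk.ne'
    have hnorm : ‖(((k : ℝ)⁻¹ : ℝ) : 𝕜)‖₊ = k⁻¹ := by
      ext; simp
    have hlux : luxemburg Φ t ((((k : ℝ)⁻¹ : ℝ) : 𝕜) • u) ≤ 1 := by
      refine luxemburg_le one_pos ?_
      have := modular_smul (Φ := Φ) (t := t) hk𝕜 k u
      rw [hnorm, inv_mul_cancel₀ hk.ne'] at this
      rwa [this]
    have := hunit t _ (MemE.const_smul hu hk𝕜) hlux ((((k : ℝ)⁻¹ : ℝ) : 𝕜) • z)
      (by rw [map_smul, hz, inputIntegral_smul])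
    rwa [nnnorm_smul, hnorm, inv_mul_le_iff₀ hk, mul_comm] at this
  obtain ⟨k, hk, hmod⟩ := hu.1.exists_modular_le_one hΦ
  change ‖z‖₊ ≤ C * luxemburg Φ t u
  rcases eq_zero_or_pos C with hC | hC
  · simpa [hC] using hbound k hk hmod
  · rw [← div_le_iff₀' hC]
    refine le_csInf ⟨k, hk, hmod⟩ fun l hl => ?_
    rw [div_le_iff₀' hC]
    exact hbound l hl.1 hl.2

theorem isSISS_of_infiniteTimeAdmissible (hA : S.InfiniteTimeAdmissible (.orlicz Φ))
    (hT : S.T.StronglyStable) : S.IsSISS (.orlicz Φ) := by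
  obtain ⟨hadm, c, hc⟩ := hA
  have hβ : ∀ x : X, ∃ γ, ClassL γ ∧ ∀ t, ‖S.T.op t x‖₊ ≤ γ t := fun x =>
    exists_classL_ge (S.T.continuous_orbit x).nnnorm (by simpa using (hT x).nnnorm)
  choose β hβL hβ using hβ
  -- The gain uses `c + 1` because `c` may be zero and the gain must be strictly increasing.
  refine ⟨fun r => (c + 1) * r, β, ⟨by simp, by fun_prop, fun r s h => ?_⟩, fun x _ => hβL x,
    fun t x₀ u hu => ?_⟩
  · exact mul_lt_mul_of_pos_left h (by positivity)
  have hz : ∃ z : X, S.emb z = S.inputIntegral t (reflect t u) ∧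
      ‖z‖₊ ≤ (c + 1) * luxemburg Φ t u := by
    rcases eq_zero_or_pos t with rfl | ht
    · exact ⟨0, by simp [inputIntegral, vol_zero], by simp⟩
    · obtain ⟨z, hz⟩ := hadm t ht (reflect t u) (MemE.reflect hu)
      refine ⟨z, hz, ?_⟩
      have h1 : ‖z‖₊ ≤ c * luxemburg Φ t (reflect t u) := hc t ht _ (MemE.reflect hu) z hz
      rw [luxemburg_reflect] at h1
      exact h1.trans (by gcongr; exact le_self_add)
  obtain ⟨z, hz, hle⟩ := hz
  refine ⟨S.T.op t x₀ + z, by rw [map_add, hz, mildSolution_eq], ?_⟩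
  exact (nnnorm_add_le _ _).trans (add_le_add (hβ x₀ t) hle)

theorem isSIISS_top_of_isSISS (hΦ : IsYoung Φ) (h : S.IsSISS (.orlicz Φ)) :
    S.IsSIISS (.lebesgue ⊤) := by
  obtain ⟨μ, β, hμ, hβ, h⟩ := h
  obtain ⟨ν, C, hν, hC⟩ := hΦ.classK_toNNReal.exists_classK_dominating
  set g : ℝ≥0 → ℝ≥0 := fun a => ⨅ n : ℕ, (1 + C n * a) / (n + 1 : ℝ≥0)
  have hg0 : g 0 = 0 := iInf_affine_div_zero C
  -- The summand `a` supplies strict growth and unboundedness: `g` is only known to be monotone and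
  -- `μ` may be bounded.
  refine ⟨fun a => μ (g a) + a, ν, β, ⟨⟨by simp [hg0, hμ.1], ?_, ?_⟩, ?_⟩, hν, hβ,
    fun t x₀ u hu => ?_⟩
  · exact (hμ.2.1.comp (continuous_iInf_affine_div C)).add continuous_id
  · exact (hμ.2.2.monotone.comp (monotone_iInf_affine_div C)).add_strictMono strictMono_id
  · exact tendsto_atTop_mono (fun a => le_add_self) tendsto_id
  have hfin := lintegral_comp_nnnorm_lt_top hν.2.2.monotone hu
  obtain ⟨x, hx, hle⟩ := h t x₀ u (memE_of_memLp_top hΦ hu)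
  refine ⟨x, hx, hfin, hle.trans (add_le_add le_rfl (le_add_right (hμ.2.2.monotone ?_)))⟩
  exact le_ciInf fun n => luxemburg_le_of_dominating hΦ (hC n) hfin

end LinearSystem

end StrongISS

theorem theorem3p3 {𝕜 X U : Type*} [RCLike 𝕜]
    [NormedAddCommGroup X] [NormedSpace 𝕜 X] [CompleteSpace X]
    [NormedAddCommGroup U] [NormedSpace 𝕜 U] [CompleteSpace U]
    (S : StrongISS.LinearSystem 𝕜 X U) :
    (∀ Φ : ℝ → ℝ, StrongISS.IsYoung Φ →
      (S.IsSISS (.orlicz Φ) ↔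
        S.InfiniteTimeAdmissible (.orlicz Φ) ∧ S.T.StronglyStable)) ∧
    ((∃ Φ : ℝ → ℝ, StrongISS.IsYoung Φ ∧ S.IsSISS (.orlicz Φ)) →
      S.IsSIISS (.lebesgue ⊤)) :=
  ⟨fun _ hΦ => ⟨fun h => ⟨StrongISS.LinearSystem.infiniteTimeAdmissible_of_isSISS hΦ h,
      StrongISS.LinearSystem.stronglyStable_of_isSISS hΦ h⟩,
    fun h => StrongISS.LinearSystem.isSISS_of_infiniteTimeAdmissible h.1 h.2⟩,
    fun ⟨_, hΦ, h⟩ => StrongISS.LinearSystem.isSIISS_top_of_isSISS hΦ h⟩
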